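/- Let $X_1,X_2,\dots$ be i.i.d. real random variables with a density $f\ge 0$ (with respect to Lebesgue measure) and distribution function $F$; write $\bar F=1-F$, $M_n=\max(X_1,\dots,X_n)$ and $a_n=\inf\{x: F(x)>1-\tfrac1n\}$. Let $\alpha>0$ and suppose that the von Mises condition $$\frac{t f(t)}{F(t)\bar F(t)}-\alpha\;\longrightarrow\;0\qquad(t\to\infty)$$ holds (so that $F$ is in the max domain of attraction of the Fréchet law $\Phi_\alpha$). Put $$h(x)=\sup_{t\ge x}\Big|\frac{t f(t)}{F(t)\bar F(t)}-\alpha\Big| ,$$ and suppose that $L(x)=-x^{\alpha}\log F(x)$ is slowly varying with remainder function $h$, that is, $L(a_nx)/L(a_n)-1=O(h(a_n))$ as $n\to\infty$ for every $x>0$. Let $\delta>0$ be such that $h(\delta)<\alpha$ (in particular $F>0$ on $[\delta,\infty)$ and $h(\delta)<\infty$), and suppose that for some $\rho>0$ and all $n\ge1$ with $a_n>\delta$ $$\frac{h(a_nx)}{h(a_n)}\le x^{-\rho}\qquad\text{for } \frac{\delta}{a_n}\le x\le 1 .$$ Suppose finally that $\sup_{x\in\mathbb R}f(x)<\infty$.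 Then, whenever $a_n>0$, the function $g_n(x)=n\,a_n f(a_nx)F(a_nx)^{n-1}$ is a density of $M_n/a_n$; moreover $a_n>0$ for all large $n$, and with the Fréchet density $\phi_\alpha(x)=\alpha x^{-\alpha-1}e^{-x^{-\alpha}}$ for $x>0$, $\phi_\alpha(x)=0$ for $x\le0$, there are constants $C_1,C_2>0$ (not depending on $n$) such that for all large $n$ $$\sup_{x\in\mathbb R}|g_n(x)-\phi_\alpha(x)|<C_1\,h(a_n)+C_2\,n e^{-\sqrt n}.$$ -/

import Mathlib

open MeasureTheory ProbabilityTheory Filter Topology Asymptotics Set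

noncomputable section

namespace FrechetRate

/-- The Fréchet density `φ_α`. -/
def frechetDensity (α x : ℝ) : ℝ :=
  if x ≤ 0 then 0 else α * x ^ (-(α + 1)) * Real.exp (-x ^ (-α))

/-- The norming constants `a_n = inf {x : F x > 1 - 1/n}`. -/
def normConst (F : ℝ → ℝ) (n : ℕ) : ℝ :=
  sInf {x : ℝ | 1 - 1 / (n : ℝ) < F x}

/-- The signed von Mises remainder `t f(t) / (F(t) (1 - F(t))) - α`. Where `F(t) (1 - F(t)) = 0`
the value is `-α`. -/
def vonMisesRemainder (F f : ℝ → ℝ) (α t : ℝ) : ℝ :=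
  t * f t / (F t * (1 - F t)) - α

/-- The values `|t f(t) / (F(t) (1 - F(t))) - α|` for `t ≥ x`. -/
def remainderTail (F f : ℝ → ℝ) (α x : ℝ) : Set ℝ :=
  (fun t => |vonMisesRemainder F f α t|) '' Ici x

/-- The nonincreasing remainder function `h(x) = sup_{t ≥ x} |t f(t) / (F(t) (1 - F(t))) - α|`;
it is meaningful for those `x` at which `remainderTail F f α x` is bounded. -/
def remainder (F f : ℝ → ℝ) (α x : ℝ) : ℝ :=
  sSup (remainderTail F f α x)

/-- The function `L(x) = -x^α log F(x)`. -/
def slowPart (F : ℝ → ℝ) (α x : ℝ) : ℝ :=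
  -x ^ α * Real.log (F x)

/-- `L(a_n x) / L(a_n) - 1 = O(h(a_n))` for every `x > 0`: the function `L` is slowly varying
with remainder function `h`. -/
def SlowlyVaryingWithRemainder (L h : ℝ → ℝ) (a : ℕ → ℝ) : Prop :=
  ∀ x : ℝ, 0 < x → (fun n : ℕ => L (a n * x) / L (a n) - 1) =O[atTop] (fun n : ℕ => h (a n))

/-- The partial maximum of the first `n` variables (for `n ≥ 1`). -/
def partialMax {Ω : Type*} (X : ℕ → Ω → ℝ) (n : ℕ) (ω : Ω) : ℝ :=
  ⨆ i : Fin n, X i ω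

/-- The density `g_n(x) = n a_n f(a_n x) F(a_n x)^(n-1)` of `M_n / a_n`. -/
def maxDensity (F f : ℝ → ℝ) (n : ℕ) (x : ℝ) : ℝ :=
  n * normConst F n * f (normConst F n * x) * F (normConst F n * x) ^ (n - 1)

end FrechetRate

end

namespace FrechetRate

/-! ### Absolutely continuous functions -/

/-! Let `u = (1 - F) / F` be the odds and `ε` the von Mises remainder. Almost everywhere `(log u)' =
-(α + ε(t)) / t`, so `log u` is nearly linear in `log t` (`abs_log_odds_sub_le`). Since `F` is
differentiable only almost everywhere, integrating this rests on absolute continuity. With `y = n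
u(a_n x)` and `z = x ^ (-α)`, one has `g_n(x) = (α + ε) y (1 + y/n)^(-(n+1)) / x` and `φ_α(x) = α z
e^(-z) / x`. As `u(a_n) = 1/(n-1)`, `log y - log z` is `O(h |log x| + 1/n)`, with `h = h(a_n)` for
`x ≥ 1` and `h(a_n x)` for `x < 1`. For `x ≥ 1` the decay of `y` and `z` absorbs the logarithm
(`kernel_bound_right`). For `δ/a_n ≤ x < 1` the bound `h(a_n x) ≤ h(a_n) x^(-ρ)` loses only powers
of `1/x`, which both kernels beat (`kernel_bound_left`). For `x < δ/a_n` both densities are small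
separately. This gives `O(h(a_n) + 1/n)`. Slow variation with remainder then yields `1/n =
O(h(a_n))` (`eventually_inv_le_remainder`): the quadratic term of `log (1 + u)` makes
`L(2a_n)/L(a_n)` exceed `1` by order `1/n`, up to `O(h(a_n))`. -/

lemma absolutelyContinuous_comp_of_lipschitzOnWith {G φ : ℝ → ℝ} {a b : ℝ} {K : NNReal}
    (hG : AbsolutelyContinuousOnInterval G a b) (hφ : LipschitzOnWith K φ (G '' uIcc a b)) :
    AbsolutelyContinuousOnInterval (fun x => φ (G x)) a b := by
  have h0 := Tendsto.const_mul (K : ℝ) hG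
  rw [mul_zero] at h0
  refine squeeze_zero' (Eventually.of_forall fun _ => Finset.sum_nonneg fun _ _ => dist_nonneg) ?_
    h0
  refine eventually_inf_principal.2 (Eventually.of_forall fun I hI => ?_)
  rw [Finset.mul_sum]
  exact Finset.sum_le_sum fun i hi =>
    hφ.dist_le_mul _ (mem_image_of_mem _ (hI.1 i hi).1) _ (mem_image_of_mem _ (hI.1 i hi).2)

/-- By compactness `G` has a positive minimum `m`, and `log` is Lipschitz with constant `1/m` on
`[m, ∞)`. -/
lemma absolutelyContinuous_log {G : ℝ → ℝ} {a b : ℝ}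
    (hG : AbsolutelyContinuousOnInterval G a b) (hpos : ∀ x ∈ uIcc a b, 0 < G x) :
    AbsolutelyContinuousOnInterval (fun x => Real.log (G x)) a b := by
  obtain ⟨x₀, hx₀, hmin⟩ := isCompact_uIcc.exists_isMinOn nonempty_uIcc hG.continuousOn
  have hc := hpos x₀ hx₀
  have key : ∀ u v : ℝ, G x₀ ≤ u → G x₀ ≤ v → Real.log u - Real.log v ≤ (G x₀)⁻¹ * |u - v| := by
    intro u v hu hv
    have hu0 := hc.trans_le hu
    have hv0 := hc.trans_le hv
    rw [← Real.log_div hu0.ne' hv0.ne']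
    calc Real.log (u / v) ≤ u / v - 1 := Real.log_le_sub_one_of_pos (div_pos hu0 hv0)
      _ = v⁻¹ * (u - v) := by field_simp
      _ ≤ v⁻¹ * |u - v| := by gcongr; exact le_abs_self _
      _ ≤ (G x₀)⁻¹ * |u - v| := by gcongr
  refine absolutelyContinuous_comp_of_lipschitzOnWith (K := ⟨(G x₀)⁻¹, by positivity⟩) hG ?_
  refine LipschitzOnWith.of_dist_le_mul ?_
  rintro _ ⟨x, hx, rfl⟩ _ ⟨y, hy, rfl⟩
  rw [Real.dist_eq, Real.dist_eq]
  refine abs_sub_le_iff.2 ⟨key _ _ (hmin hx) (hmin hy), ?_⟩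
  rw [abs_sub_comm]
  exact key _ _ (hmin hy) (hmin hx)

lemma absolutelyContinuous_pow {G : ℝ → ℝ} {a b : ℝ}
    (hG : AbsolutelyContinuousOnInterval G a b) (n : ℕ) :
    AbsolutelyContinuousOnInterval (fun x => G x ^ n) a b := by
  induction n with
  | zero =>
    simp only [pow_zero]
    exact (LipschitzOnWith.absolutelyContinuousOnInterval (K := 0)
      ((LipschitzWith.const (1 : ℝ)).lipschitzOnWith))
  | succ k ih => simp only [pow_succ]; exact ih.fun_mul hG

/-- Comparison of an absolutely continuous function with the sign of its derivative. -/
lemma le_of_ae_hasDerivAt_nonneg {G G' : ℝ → ℝ} {a b : ℝ} (hab : a ≤ b)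
    (hG : AbsolutelyContinuousOnInterval G a b)
    (hd : ∀ᵐ x, x ∈ Icc a b → HasDerivAt G (G' x) x) (hn : ∀ x ∈ Icc a b, 0 ≤ G' x) :
    G a ≤ G b := by
  have h1 := hG.integral_deriv_eq_sub
  have h2 : 0 ≤ ∫ x in a..b, deriv G x := by
    refine intervalIntegral.integral_nonneg_of_ae_restrict hab ?_
    refine (ae_restrict_iff' measurableSet_Icc).2 ?_
    filter_upwards [hd] with x hx hxm
    rw [(hx hxm).deriv]
    exact hn x hxm
  linarith

/-! ### Distribution functions with a density -/

section cdf

variable {F f : ℝ → ℝ}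

lemma cdf_eq_add_intervalIntegral (hf : Integrable f) (hF : ∀ x, F x = ∫ t in Iic x, f t)
    (a x : ℝ) : F x = F a + ∫ t in a..x, f t := by
  rw [hF, hF, ← intervalIntegral.integral_Iic_sub_Iic hf.integrableOn hf.integrableOn]
  ring

lemma cdf_absolutelyContinuous (hf : Integrable f) (hF : ∀ x, F x = ∫ t in Iic x, f t)
    (a b : ℝ) : AbsolutelyContinuousOnInterval F a b := by
  have h := (hf.intervalIntegrable (a := a) (b := b)).absolutelyContinuousOnInterval_intervalIntegral
    (c := a) (by simp)
  have h2 : AbsolutelyContinuousOnInterval (fun _ : ℝ => F a) a b :=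
    LipschitzOnWith.absolutelyContinuousOnInterval (K := 0)
      ((LipschitzWith.const (F a)).lipschitzOnWith)
  have h3 := h2.fun_add h
  rwa [show F = fun x => F a + ∫ t in a..x, f t from
    funext (cdf_eq_add_intervalIntegral hf hF a)]

lemma cdf_ae_hasDerivAt (hf : Integrable f) (hF : ∀ x, F x = ∫ t in Iic x, f t) :
    ∀ᵐ x, HasDerivAt F (f x) x := by
  filter_upwards [LocallyIntegrable.ae_hasDerivAt_integral hf.locallyIntegrable] with x hx
  rw [show F = fun x => F 0 + ∫ t in (0 : ℝ)..x, f t from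
    funext (cdf_eq_add_intervalIntegral hf hF 0)]
  exact (hx 0).const_add _

lemma cdf_continuous (hf : Integrable f) (hF : ∀ x, F x = ∫ t in Iic x, f t) :
    Continuous F := by
  rw [show F = fun x => F 0 + ∫ t in (0 : ℝ)..x, f t from
    funext (cdf_eq_add_intervalIntegral hf hF 0)]
  exact continuous_const.add (intervalIntegral.continuous_primitive (fun _ _ =>
    hf.intervalIntegrable) 0)

lemma cdf_monotone (hf : Integrable f) (hf0 : ∀ x, 0 ≤ f x)
    (hF : ∀ x, F x = ∫ t in Iic x, f t) : Monotone F := by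
  intro a b hab
  rw [cdf_eq_add_intervalIntegral hf hF a b]
  have := intervalIntegral.integral_nonneg (μ := volume) hab fun x _ => hf0 x
  linarith

lemma cdf_tendsto_atTop (hf : Integrable f) (hF : ∀ x, F x = ∫ t in Iic x, f t) :
    Tendsto F atTop (𝓝 (∫ t, f t)) := by
  rw [show F = fun x => ∫ t in Iic x, f t from funext hF]
  have h := tendsto_setIntegral_of_monotone (μ := volume) (f := f) (s := fun x : ℝ => Iic x)
    (fun _ => measurableSet_Iic) (fun _ _ h => Iic_subset_Iic.2 h) hf.integrableOn
  rwa [iUnion_Iic, setIntegral_univ] at h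

lemma cdf_tendsto_atBot (hf : Integrable f) (hF : ∀ x, F x = ∫ t in Iic x, f t) :
    Tendsto F atBot (𝓝 0) := by
  have h := intervalIntegral_tendsto_integral_Iic (0 : ℝ) (hf.integrableOn (s := Iic 0)) tendsto_id
  have h2 : Tendsto (fun x => F 0 - ∫ t in x..(0 : ℝ), f t) atBot (𝓝 (F 0 - F 0)) := by
    rw [hF 0]
    exact tendsto_const_nhds.sub h
  rw [sub_self] at h2
  refine h2.congr fun x => ?_
  rw [cdf_eq_add_intervalIntegral hf hF x 0]
  ring

lemma cdf_nonneg (hf0 : ∀ x, 0 ≤ f x) (hF : ∀ x, F x = ∫ t in Iic x, f t) (x : ℝ) : 0 ≤ F x := by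
  rw [hF]; exact integral_nonneg hf0

lemma cdf_le_integral (hf : Integrable f) (hf0 : ∀ x, 0 ≤ f x)
    (hF : ∀ x, F x = ∫ t in Iic x, f t) (x : ℝ) : F x ≤ ∫ t, f t :=
  (cdf_monotone hf hf0 hF).ge_of_tendsto (cdf_tendsto_atTop hf hF) x

/-- The `n`-th power of a distribution function with density `f` has density `n f F ^ (n - 1)`. -/
lemma integrable_density_pow (hf : Integrable f) (hf0 : ∀ x, 0 ≤ f x)
    (hF : ∀ x, F x = ∫ t in Iic x, f t) (n : ℕ) :
    Integrable fun x => n * f x * F x ^ (n - 1) := by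
  refine (hf.const_mul (n : ℝ)).mul_bdd (c := (∫ t, f t) ^ (n - 1))
    ((cdf_continuous hf hF).pow _).aestronglyMeasurable (Eventually.of_forall fun x => ?_)
  have h0 := cdf_nonneg hf0 hF x
  rw [Real.norm_of_nonneg (by positivity)]
  exact pow_le_pow_left₀ h0 (cdf_le_integral hf hf0 hF x) _

lemma integral_density_pow (hf : Integrable f) (hf0 : ∀ x, 0 ≤ f x)
    (hF : ∀ x, F x = ∫ t in Iic x, f t) {n : ℕ} (hn : 1 ≤ n) (x : ℝ) :
    ∫ t in Iic x, n * f t * F t ^ (n - 1) = F x ^ n := by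
  have h1 := intervalIntegral_tendsto_integral_Iic x
    ((integrable_density_pow hf hf0 hF n).integrableOn (s := Iic x)) tendsto_id
  have h2 : Tendsto (fun c => F x ^ n - F c ^ n) atBot (𝓝 (F x ^ n - 0 ^ n)) :=
    tendsto_const_nhds.sub ((cdf_tendsto_atBot hf hF).pow n)
  rw [zero_pow (by omega), sub_zero] at h2
  refine tendsto_nhds_unique h1 (h2.congr fun c => ?_)
  rw [← (absolutelyContinuous_pow (cdf_absolutelyContinuous hf hF c x) n).integral_deriv_eq_sub]
  refine intervalIntegral.integral_congr_ae ?_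
  filter_upwards [cdf_ae_hasDerivAt hf hF] with t ht _
  rw [(ht.fun_pow n).deriv]
  ring

end cdf

/-! ### The density of the normalised maximum -/

lemma partialMax_le_iff {Ω : Type*} {X : ℕ → Ω → ℝ} {n : ℕ} (hn : 1 ≤ n) (ω : Ω) (x : ℝ) :
    partialMax X n ω ≤ x ↔ ∀ i ∈ Finset.range n, X i ω ≤ x := by
  have : Nonempty (Fin n) := ⟨⟨0, hn⟩⟩
  unfold partialMax
  rw [ciSup_le_iff (finite_range _).bddAbove]
  exact ⟨fun h i hi => h ⟨i, Finset.mem_range.1 hi⟩, fun h i => h i (Finset.mem_range.2 i.2)⟩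

section law

variable {Ω : Type*} [MeasurableSpace Ω] {P : Measure Ω} [IsProbabilityMeasure P]
  {X : ℕ → Ω → ℝ} {F f : ℝ → ℝ}

lemma integrable_of_hasLaw (hfm : Measurable f) (hf0 : ∀ x, 0 ≤ f x) {Y : Ω → ℝ}
    (hY : HasLaw Y (volume.withDensity fun x => ENNReal.ofReal (f x)) P) : Integrable f := by
  have h : IsProbabilityMeasure (volume.withDensity fun x => ENNReal.ofReal (f x)) :=
    (hY.isProbabilityMeasure_iff).1 inferInstance
  refine ⟨hfm.aestronglyMeasurable, ?_⟩
  rw [hasFiniteIntegral_iff_ofReal (Eventually.of_forall hf0)]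
  have h1 := h.measure_univ
  rw [withDensity_apply _ MeasurableSet.univ, setLIntegral_univ] at h1
  rw [h1]; exact ENNReal.one_lt_top

lemma measure_Iic_of_hasLaw (hfm : Measurable f) (hf0 : ∀ x, 0 ≤ f x) {Y : Ω → ℝ}
    (hY : HasLaw Y (volume.withDensity fun x => ENNReal.ofReal (f x)) P) (x : ℝ) :
    P {ω | Y ω ≤ x} = ENNReal.ofReal (∫ t in Iic x, f t) := by
  rw [hY.measure_eq (p := fun y => y ≤ x) measurableSet_Iic]
  change (volume.withDensity fun x => ENNReal.ofReal (f x)) (Iic x) = _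
  rw [withDensity_apply _ measurableSet_Iic, ofReal_integral_eq_lintegral_ofReal
    (integrable_of_hasLaw hfm hf0 hY).integrableOn (Eventually.of_forall hf0)]

lemma integral_eq_one_of_hasLaw (hfm : Measurable f) (hf0 : ∀ x, 0 ≤ f x) {Y : Ω → ℝ}
    (hY : HasLaw Y (volume.withDensity fun x => ENNReal.ofReal (f x)) P) : ∫ t, f t = 1 := by
  have h : IsProbabilityMeasure (volume.withDensity fun x => ENNReal.ofReal (f x)) :=
    (hY.isProbabilityMeasure_iff).1 inferInstance
  have h1 := h.measure_univ
  rw [withDensity_apply _ MeasurableSet.univ, setLIntegral_univ] at h1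
  rw [integral_eq_lintegral_of_nonneg_ae (Eventually.of_forall hf0) hfm.aestronglyMeasurable, h1]
  rfl

/-- Both measures are compared on half-lines: independence gives `F (a x) ^ n`, and `x ↦ F (a x)` is
itself the distribution function of the density `a f(a x)`, so `integral_density_pow` applies to it.
-/
lemma hasLaw_partialMax_div (hfm : Measurable f) (hf0 : ∀ x, 0 ≤ f x)
    (hind : iIndepFun X P)
    (hlaw : ∀ i, HasLaw (X i) (volume.withDensity fun x => ENNReal.ofReal (f x)) P)
    (hF : ∀ x, F x = ∫ t in Iic x, f t) {n : ℕ} (hn : 1 ≤ n) {a : ℝ} (ha : 0 < a) :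
    HasLaw (fun ω => partialMax X n ω / a)
      (volume.withDensity fun x => ENNReal.ofReal (n * a * f (a * x) * F (a * x) ^ (n - 1))) P := by
  have hfi := integrable_of_hasLaw hfm hf0 (hlaw 0)
  have hgi : Integrable fun x => a * f (a * x) := (hfi.comp_mul_left' ha.ne').const_mul a
  have hg0 : ∀ x, 0 ≤ a * f (a * x) := fun x => mul_nonneg ha.le (hf0 _)
  have hG : ∀ x, F (a * x) = ∫ t in Iic x, a * f (a * t) := by
    intro x
    have h := Measure.setIntegral_comp_smul_of_pos volume f (Iic x) ha
    simp only [smul_eq_mul, Module.finrank_self, pow_one,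
      LinearOrderedField.smul_Iic ha] at h
    rw [hF, integral_const_mul, h, mul_inv_cancel_left₀ ha.ne']
  have hrew : ∀ x, (n : ℝ) * a * f (a * x) * F (a * x) ^ (n - 1) =
      n * (a * f (a * x)) * F (a * x) ^ (n - 1) := fun x => by ring
  have hdi := integrable_density_pow (F := fun x => F (a * x)) hgi hg0 hG n
  have hd0 : ∀ x, 0 ≤ (n : ℝ) * (a * f (a * x)) * F (a * x) ^ (n - 1) := fun x =>
    mul_nonneg (mul_nonneg n.cast_nonneg (hg0 x)) (pow_nonneg (cdf_nonneg hf0 hF _) _)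
  simp only [hrew]
  have hM : AEMeasurable (fun ω => partialMax X n ω / a) P := by
    refine AEMeasurable.div_const ?_ a
    exact AEMeasurable.iSup fun i => (hlaw i).aemeasurable
  refine ⟨hM, ?_⟩
  have : IsFiniteMeasure (P.map fun ω => partialMax X n ω / a) := inferInstance
  refine Measure.ext_of_Iic _ _ fun x => ?_
  rw [Measure.map_apply_of_aemeasurable hM measurableSet_Iic, withDensity_apply _ measurableSet_Iic,
    ← ofReal_integral_eq_lintegral_ofReal hdi.integrableOn (Eventually.of_forall hd0),
    integral_density_pow (F := fun x => F (a * x)) hgi hg0 hG hn]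
  have hset : (fun ω => partialMax X n ω / a) ⁻¹' Iic x =
      ⋂ i ∈ Finset.range n, X i ⁻¹' Iic (a * x) := by
    ext ω
    simp only [mem_preimage, mem_Iic, mem_iInter]
    rw [div_le_iff₀' ha, partialMax_le_iff hn]
  rw [hset, hind.measure_inter_preimage_eq_mul (Finset.range n) (fun _ _ => measurableSet_Iic)]
  have hi : ∀ i ∈ Finset.range n, P (X i ⁻¹' Iic (a * x)) = ENNReal.ofReal (F (a * x)) := by
    intro i _
    rw [hF]
    exact measure_Iic_of_hasLaw hfm hf0 (hlaw i) _
  rw [Finset.prod_congr rfl hi, Finset.prod_const, Finset.card_range,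
    ENNReal.ofReal_pow (cdf_nonneg hf0 hF _)]

end law

/-! ### The remainder function -/

section remainder

variable {F f : ℝ → ℝ} {α δ : ℝ}

lemma remainderTail_anti {s t : ℝ} (hst : s ≤ t) :
    remainderTail F f α t ⊆ remainderTail F f α s :=
  image_mono (Ici_subset_Ici.2 hst)

lemma abs_vonMisesRemainder_le (hb : BddAbove (remainderTail F f α δ)) {s t : ℝ} (hs : δ ≤ s)
    (hst : s ≤ t) : |vonMisesRemainder F f α t| ≤ remainder F f α s :=
  le_csSup (hb.mono (remainderTail_anti hs)) ⟨t, hst, rfl⟩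

lemma remainder_anti (hb : BddAbove (remainderTail F f α δ)) {s t : ℝ} (hs : δ ≤ s)
    (hst : s ≤ t) : remainder F f α t ≤ remainder F f α s :=
  csSup_le_csSup (hb.mono (remainderTail_anti hs)) ⟨_, t, self_mem_Ici, rfl⟩ (remainderTail_anti hst)

lemma remainder_nonneg (hb : BddAbove (remainderTail F f α δ)) {s : ℝ} (hs : δ ≤ s) :
    0 ≤ remainder F f α s :=
  (abs_nonneg _).trans (abs_vonMisesRemainder_le hb hs le_rfl)

/-- Division by zero gives the remainder the value `-α`, whose modulus already exceeds `h(δ)`. -/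
lemma cdf_mul_ne_zero (hα : 0 < α) (hb : BddAbove (remainderTail F f α δ))
    (hδ : remainder F f α δ < α) {t : ℝ} (ht : δ ≤ t) : F t * (1 - F t) ≠ 0 := by
  intro h
  have h1 := abs_vonMisesRemainder_le hb le_rfl ht
  rw [vonMisesRemainder, h, div_zero, zero_sub, abs_neg, abs_of_pos hα] at h1
  linarith

lemma cdf_mem_Ioo (hα : 0 < α) (hb : BddAbove (remainderTail F f α δ))
    (hδ : remainder F f α δ < α) (h0 : ∀ x, 0 ≤ F x) (h1 : ∀ x, F x ≤ 1) {t : ℝ} (ht : δ ≤ t) :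
    0 < F t ∧ F t < 1 := by
  have h := cdf_mul_ne_zero hα hb hδ ht
  refine ⟨(h0 t).lt_of_ne fun h' => h (by simp [← h']), (h1 t).lt_of_ne fun h' => h (by simp [h'])⟩

end remainder

/-! ### The odds of exceeding a level -/

/-- The odds `(1 - F t) / F t` of exceeding the level `t`. -/
noncomputable def odds (F : ℝ → ℝ) (t : ℝ) : ℝ := (1 - F t) / F t

section odds

variable {F f : ℝ → ℝ} {α δ : ℝ}

/-- If `|t f t / (F t (1 - F t)) - α| ≤ η` on `[s, t]`, then the odds decay like a power with
exponent between `α - η` and `α + η`. -/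
lemma abs_log_odds_sub_le (hf : Integrable f) (hF : ∀ x, F x = ∫ t in Iic x, f t)
    {s t η : ℝ} (hs : 0 < s) (hst : s ≤ t) (hpos : ∀ τ ∈ Icc s t, 0 < F τ ∧ F τ < 1)
    (hη : ∀ τ ∈ Icc s t, |vonMisesRemainder F f α τ| ≤ η) :
    |Real.log (odds F t) - Real.log (odds F s) + α * (Real.log t - Real.log s)| ≤
      η * (Real.log t - Real.log s) := by
  have hlog : ∀ τ ∈ Icc s t, Real.log (odds F τ) = Real.log (1 - F τ) - Real.log (F τ) :=
    fun τ hτ => Real.log_div (by linarith [hpos τ hτ]) (by linarith [hpos τ hτ])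
  have hu : uIcc s t = Icc s t := uIcc_of_le hst
  have hid : AbsolutelyContinuousOnInterval (fun x : ℝ => x) s t :=
    LipschitzOnWith.absolutelyContinuousOnInterval (K := 1) LipschitzWith.id.lipschitzOnWith
  have hone : AbsolutelyContinuousOnInterval (fun _ : ℝ => (1 : ℝ)) s t :=
    LipschitzOnWith.absolutelyContinuousOnInterval (K := 0)
      ((LipschitzWith.const (1 : ℝ)).lipschitzOnWith)
  have hFac := cdf_absolutelyContinuous hf hF s t
  have hl1 := absolutelyContinuous_log hid (fun τ hτ => hs.trans_le (hu ▸ hτ).1)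
  have hl2 := absolutelyContinuous_log hFac (fun τ hτ => (hpos τ (hu ▸ hτ)).1)
  have hl3 := absolutelyContinuous_log (hone.fun_sub hFac)
    (fun τ hτ => by linarith [(hpos τ (hu ▸ hτ)).2])
  -- Adding `β log τ` to the log-odds gives the derivative `(β - α - ε(τ)) / τ`, which is
  -- nonnegative for `β = α + η` and nonpositive for `β = α - η`.
  have hac : ∀ β : ℝ, AbsolutelyContinuousOnInterval
      (fun τ => Real.log (1 - F τ) - Real.log (F τ) + β * Real.log τ) s t := fun β =>
    (hl3.fun_sub hl2).fun_add (hl1.const_mul β)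
  have hder : ∀ β : ℝ, ∀ᵐ τ, τ ∈ Icc s t → HasDerivAt
      (fun τ => Real.log (1 - F τ) - Real.log (F τ) + β * Real.log τ)
      ((β - α - vonMisesRemainder F f α τ) / τ) τ := by
    intro β
    filter_upwards [cdf_ae_hasDerivAt hf hF] with τ hτ hm
    have hp := hpos τ hm
    have hτ0 : τ ≠ 0 := by linarith [hm.1]
    have hF1 : 1 - F τ ≠ 0 := by linarith
    have hF0 : F τ ≠ 0 := by linarith
    have h := (((hτ.const_sub 1).log hF1).sub (hτ.log hF0)).add
      ((Real.hasDerivAt_log hτ0).const_mul β)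
    convert! h using 1
    unfold vonMisesRemainder
    field_simp
    ring
  have hτ0 : ∀ τ ∈ Icc s t, 0 < τ := fun τ hτ => hs.trans_le hτ.1
  have hup := le_of_ae_hasDerivAt_nonneg hst (hac (α + η)) (hder (α + η)) fun τ hτ =>
    div_nonneg (by linarith [(abs_le.1 (hη τ hτ)).2]) (hτ0 τ hτ).le
  have hdn := le_of_ae_hasDerivAt_nonneg hst (hac (α - η)).neg
    (G' := fun τ => -((α - η - α - vonMisesRemainder F f α τ) / τ)) (by
      filter_upwards [hder (α - η)] with τ hτ hm
      exact (hτ hm).neg) fun τ hτ => by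
        rw [← neg_div]
        exact div_nonneg (by linarith [(abs_le.1 (hη τ hτ)).1]) (hτ0 τ hτ).le
  simp only [Pi.neg_apply] at hdn
  rw [hlog s (left_mem_Icc.2 hst), hlog t (right_mem_Icc.2 hst), abs_le]
  constructor <;> nlinarith

end odds

/-! ### The norming constants -/

section normConst

variable {F : ℝ → ℝ}

/-- The superlevel set is open, so its infimum lies outside it (giving `≤`) but in its closure
(giving `≥`). With `n ≥ 2` the level is positive, which makes the set bounded below. -/
lemma apply_normConst (hc : Continuous F) (hm : Monotone F) (htop : Tendsto F atTop (𝓝 1))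
    (hbot : Tendsto F atBot (𝓝 0)) {n : ℕ} (hn : 2 ≤ n) : F (normConst F n) = 1 - 1 / n := by
  have hn' : (2 : ℝ) ≤ n := by exact_mod_cast hn
  have h1 : 0 < 1 / (n : ℝ) := by positivity
  have h2 : 1 / (n : ℝ) ≤ 1 / 2 := by gcongr
  set S := {x : ℝ | 1 - 1 / (n : ℝ) < F x} with hS
  have hne : S.Nonempty := (htop.eventually_const_lt (by linarith)).exists
  have hbdd : BddBelow S := by
    obtain ⟨b, hb⟩ := (hbot.eventually_lt_const (show (0 : ℝ) < 1 - 1 / n by linarith)).exists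
    refine ⟨b, fun x hx => ?_⟩
    by_contra! hxb
    have h3 : 1 - 1 / (n : ℝ) < F x := hx
    exact absurd (hm hxb.le) (by linarith)
  have hopen : IsOpen S := isOpen_lt continuous_const hc
  have hnot : normConst F n ∉ S := fun h => by
    have hS' : S ∩ Iio (normConst F n) ∈ 𝓝[<] (normConst F n) :=
      inter_mem (nhdsWithin_le_nhds (hopen.mem_nhds h)) self_mem_nhdsWithin
    obtain ⟨y, hy, hyS⟩ := NeBot.nonempty_of_mem inferInstance hS'
    exact absurd (csInf_le hbdd hy) (not_le.2 hyS)
  have hcl : normConst F n ∈ closure S := csInf_mem_closure hne hbdd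
  have hge : normConst F n ∈ {x : ℝ | 1 - 1 / (n : ℝ) ≤ F x} :=
    closure_minimal (fun x hx => le_of_lt hx) (isClosed_le continuous_const hc) hcl
  exact le_antisymm (not_lt.1 hnot) hge

lemma tendsto_normConst (hc : Continuous F) (hm : Monotone F) (htop : Tendsto F atTop (𝓝 1))
    (hbot : Tendsto F atBot (𝓝 0)) (hlt : ∀ x, F x < 1) :
    Tendsto (normConst F) atTop atTop := by
  refine tendsto_atTop.2 fun K => ?_
  have h : Tendsto (fun n : ℕ => 1 - 1 / (n : ℝ)) atTop (𝓝 (1 - 0)) :=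
    tendsto_const_nhds.sub tendsto_one_div_atTop_nhds_zero_nat
  rw [sub_zero] at h
  filter_upwards [h.eventually_const_lt (hlt K), eventually_ge_atTop 2] with n hn hn2
  rw [← apply_normConst hc hm htop hbot hn2] at hn
  exact (hm.reflect_lt hn).le

lemma odds_normConst (hc : Continuous F) (hm : Monotone F) (htop : Tendsto F atTop (𝓝 1))
    (hbot : Tendsto F atBot (𝓝 0)) {n : ℕ} (hn : 2 ≤ n) :
    odds F (normConst F n) = 1 / ((n : ℝ) - 1) := by
  have hn' : (2 : ℝ) ≤ n := by exact_mod_cast hn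
  have : (n : ℝ) - 1 ≠ 0 := by linarith
  rw [odds, apply_normConst hc hm htop hbot hn]
  field_simp
  ring

end normConst

/-! ### Elementary inequalities -/

/-- Bernoulli's inequality with the real exponent `n / N`. It makes the decay of order `N` in
`inv_one_add_div_pow_le` uniform in `n ≥ N`. -/
lemma one_add_div_pow_le {N n : ℕ} (hN : 1 ≤ N) (hNn : N ≤ n) {y : ℝ} (hy : 0 ≤ y) :
    (1 + y / N) ^ N ≤ (1 + y / n) ^ n := by
  have hN0 : (0 : ℝ) < N := by exact_mod_cast hN
  have hn0 : (0 : ℝ) < n := by exact_mod_cast hN.trans hNn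
  have hNn' : (N : ℝ) ≤ n := by exact_mod_cast hNn
  have hq : 0 ≤ y / n := by positivity
  have hB := one_add_mul_self_le_rpow_one_add (s := y / n) (by linarith) (p := n / N)
    ((one_le_div hN0).2 hNn')
  have h1 : (n : ℝ) / N * (y / n) = y / N := by field_simp
  rw [h1] at hB
  calc (1 + y / N) ^ N ≤ ((1 + y / n) ^ ((n : ℝ) / N)) ^ N :=
        pow_le_pow_left₀ (by positivity) hB N
    _ = (1 + y / n) ^ n := by
        rw [← Real.rpow_natCast, ← Real.rpow_mul (by positivity), div_mul_cancel₀ _ hN0.ne',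
          Real.rpow_natCast]

lemma inv_one_add_div_pow_le {N n : ℕ} (hN : 1 ≤ N) (hNn : N ≤ n) {y : ℝ} (hy : 0 < y) :
    ((1 + y / n) ^ (n + 1))⁻¹ ≤ (N : ℝ) ^ N * (y ^ N)⁻¹ := by
  have hN0 : (0 : ℝ) < N := by exact_mod_cast hN
  have hq : 0 ≤ y / n := by positivity
  have h1 : (y / N) ^ N ≤ (1 + y / n) ^ (n + 1) :=
    calc (y / N) ^ N ≤ (1 + y / N) ^ N := pow_le_pow_left₀ (by positivity) (by linarith) N
      _ ≤ (1 + y / n) ^ n := one_add_div_pow_le hN hNn hy.le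
      _ ≤ (1 + y / n) ^ (n + 1) := pow_le_pow_right₀ (by linarith) (by omega)
  calc ((1 + y / n) ^ (n + 1))⁻¹ ≤ ((y / N) ^ N)⁻¹ := inv_anti₀ (by positivity) h1
    _ = (N : ℝ) ^ N * (y ^ N)⁻¹ := by rw [div_pow, inv_div, div_eq_mul_inv]

lemma exp_neg_le_inv_pow {N : ℕ} (hN : 1 ≤ N) {y : ℝ} (hy : 0 < y) :
    Real.exp (-y) ≤ (N : ℝ) ^ N * (y ^ N)⁻¹ := by
  have hN0 : (0 : ℝ) < N := by exact_mod_cast hN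
  have h1 : (y / N) ^ N ≤ Real.exp y :=
    calc (y / N) ^ N ≤ (Real.exp (y / N)) ^ N :=
          pow_le_pow_left₀ (by positivity) (by linarith [Real.add_one_le_exp (y / N)]) N
      _ = Real.exp y := by rw [← Real.exp_nat_mul]; congr 1; field_simp
  calc Real.exp (-y) = (Real.exp y)⁻¹ := Real.exp_neg y
    _ ≤ ((y / N) ^ N)⁻¹ := inv_anti₀ (by positivity) h1
    _ = (N : ℝ) ^ N * (y ^ N)⁻¹ := by rw [div_pow, inv_div, div_eq_mul_inv]

lemma abs_exp_sub_exp_le {A B K : ℝ} (hA : Real.exp A ≤ K) (hB : Real.exp B ≤ K) :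
    |Real.exp A - Real.exp B| ≤ |A - B| * K := by
  have key : ∀ A B : ℝ, Real.exp A ≤ K → Real.exp A - Real.exp B ≤ |A - B| * K := by
    intro A B hA
    have h1 : Real.exp B = Real.exp A * Real.exp (B - A) := by rw [← Real.exp_add]; congr 1; ring
    have h2 := Real.add_one_le_exp (B - A)
    have h3 := Real.exp_pos A
    calc Real.exp A - Real.exp B = Real.exp A * (1 - Real.exp (B - A)) := by rw [h1]; ring
      _ ≤ Real.exp A * |A - B| := by
          gcongr
          linarith [le_abs_self (A - B)]
      _ ≤ |A - B| * K := by rw [mul_comm]; gcongr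
  refine abs_sub_le_iff.2 ⟨key A B hA, ?_⟩
  rw [abs_sub_comm]
  exact key B A hB

lemma abs_inv_pow_sub_exp_le {n : ℕ} (hn : 1 ≤ n) {y K : ℝ} (hy : 0 ≤ y)
    (hK : ((1 + y / n) ^ (n + 1))⁻¹ ≤ K) (hK' : Real.exp (-y) ≤ K) :
    |((1 + y / n) ^ (n + 1))⁻¹ - Real.exp (-y)| ≤ (y + y ^ 2) / n * K := by
  have hn0 : (0 : ℝ) < n := by exact_mod_cast hn
  have hq : 0 ≤ y / n := by positivity
  have hpos : 0 < 1 + y / n := by linarith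
  have hexp : ((1 + y / n) ^ (n + 1))⁻¹ = Real.exp (-((n + 1) * Real.log (1 + y / n))) := by
    rw [Real.exp_neg, mul_comm, Real.exp_mul, Real.exp_log hpos]
    norm_cast
  have hK0 : 0 ≤ K := (Real.exp_pos _).le.trans hK'
  rw [hexp] at hK ⊢
  refine (abs_exp_sub_exp_le hK hK').trans ?_
  gcongr
  have hup : Real.log (1 + y / n) ≤ y / n := by
    linarith [Real.log_le_sub_one_of_pos hpos]
  have hlo : y / (n + y) ≤ Real.log (1 + y / n) := by
    have h := Real.one_sub_inv_le_log_of_pos hpos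
    have h2 : 1 - (1 + y / n)⁻¹ = y / (n + y) := by field_simp; ring
    linarith
  -- The exponent `(n + 1) log (1 + y/n)` lies between `y - y²/n` and `y + y/n`.
  have h1 : ((n : ℝ) + 1) * (y / n) = y + y / n := by field_simp
  have h2 : y - y ^ 2 / n ≤ ((n : ℝ) + 1) * (y / (n + y)) := by
    rw [mul_div_assoc', le_div_iff₀ (by positivity), sub_mul, sub_le_iff_le_add]
    have : y ^ 2 / n * (n + y) = y ^ 2 + y ^ 3 / n := by field_simp
    rw [this]
    have : 0 ≤ y ^ 3 / n := by positivity
    nlinarith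
  have hup' := mul_le_mul_of_nonneg_left hup (by positivity : (0 : ℝ) ≤ n + 1)
  have hlo' := mul_le_mul_of_nonneg_left hlo (by positivity : (0 : ℝ) ≤ n + 1)
  have hy2 : 0 ≤ y ^ 2 / n := by positivity
  rw [add_div, abs_le]
  constructor <;> linarith

/-- Comparison of the two densities in terms of `y = n (1 - F) / F` and `z = x ^ (-α)`. -/
lemma abs_kernel_sub_le {n : ℕ} (hn : 1 ≤ n) {α ε y z K : ℝ} (hα : 0 < α) (hy : 0 ≤ y)
    (hz : 0 ≤ z) (hK : ((1 + y / n) ^ (n + 1))⁻¹ ≤ K) (hKy : Real.exp (-y) ≤ K)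
    (hKz : Real.exp (-z) ≤ K) :
    |(α + ε) * y * ((1 + y / n) ^ (n + 1))⁻¹ - α * z * Real.exp (-z)| ≤
      (|ε| * y + α * (y * (y + y ^ 2)) / n + α * (|y - z| * (1 + z))) * K := by
  set B := ((1 + y / n) ^ (n + 1))⁻¹
  have hn0 : (0 : ℝ) < n := by exact_mod_cast hn
  have hB0 : 0 ≤ B := by positivity
  have h1 : |B - Real.exp (-y)| ≤ (y + y ^ 2) / n * K := abs_inv_pow_sub_exp_le hn hy hK hKy
  have h2 : |Real.exp (-y) - Real.exp (-z)| ≤ |y - z| * K := by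
    have h := abs_exp_sub_exp_le hKy hKz
    rwa [show -y - -z = -(y - z) by ring, abs_neg] at h
  -- Telescoping: drop `ε`, replace the power kernel by `e^(-y)`, then pass from `y` to `z`.
  have hdec : (α + ε) * y * B - α * z * Real.exp (-z) = ε * y * B + α * y * (B - Real.exp (-y)) +
      (α * (y - z) * Real.exp (-y) + α * z * (Real.exp (-y) - Real.exp (-z))) := by ring
  rw [hdec]
  have e1 : |ε * y * B| ≤ |ε| * y * K := by
    rw [abs_mul, abs_mul, abs_of_nonneg hy, abs_of_nonneg hB0]; gcongr
  have e2 : |α * y * (B - Real.exp (-y))| ≤ α * y * ((y + y ^ 2) / n * K) := by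
    rw [abs_mul, abs_of_nonneg (by positivity : 0 ≤ α * y)]; gcongr
  have e3 : |α * (y - z) * Real.exp (-y)| ≤ α * |y - z| * K := by
    rw [abs_mul, abs_mul, abs_of_pos hα, abs_of_pos (Real.exp_pos _)]; gcongr
  have e4 : |α * z * (Real.exp (-y) - Real.exp (-z))| ≤ α * z * (|y - z| * K) := by
    rw [abs_mul, abs_of_nonneg (by positivity : 0 ≤ α * z)]; gcongr
  calc _ ≤ |ε * y * B| + |α * y * (B - Real.exp (-y))| +
        (|α * (y - z) * Real.exp (-y)| + |α * z * (Real.exp (-y) - Real.exp (-z))|) :=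
        (abs_add_le _ _).trans (add_le_add (abs_add_le _ _) (abs_add_le _ _))
    _ ≤ |ε| * y * K + α * y * ((y + y ^ 2) / n * K) +
        (α * |y - z| * K + α * z * (|y - z| * K)) := by gcongr
    _ = _ := by ring

/-- This quantity is `log (n u(a_n))`, the offset of `log y` at `x = 1`; it is nonzero because
`u(a_n)` is `1/(n-1)`, not `1/n`. -/
lemma log_natCast_sub_log_bounds {n : ℕ} (hn : 2 ≤ n) :
    0 ≤ Real.log n - Real.log (n - 1) ∧ Real.log n - Real.log (n - 1) ≤ 2 / n ∧
      Real.exp (Real.log n - Real.log (n - 1)) ≤ 2 := by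
  have hn' : (2 : ℝ) ≤ n := by exact_mod_cast hn
  have h1 : (0 : ℝ) < n - 1 := by linarith
  have h0 : (0 : ℝ) < n := by linarith
  rw [← Real.log_div h0.ne' h1.ne', Real.exp_log (by positivity)]
  have hle : (n : ℝ) / (n - 1) ≤ 2 := by rw [div_le_iff₀ h1]; linarith
  refine ⟨Real.log_nonneg ?_, (Real.log_le_sub_one_of_pos (by positivity)).trans ?_, hle⟩
  · rw [le_div_iff₀ h1]; linarith
  · rw [div_sub_one h1.ne', div_le_div_iff₀ h1 h0]; linarith

/-- The comparison to the right of `1`; here `l = log x`. -/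
lemma kernel_bound_right {n : ℕ} (hn : 2 ≤ n) {α η h ε l y : ℝ} (hα : 0 < α) (hηα : η < α)
    (hh : 0 ≤ h) (hhη : h ≤ η) (hε : |ε| ≤ h) (hl : 0 ≤ l) (hy : 0 < y)
    (hlog : |Real.log y - (Real.log n - Real.log (n - 1)) + α * l| ≤ h * l) :
    |(α + ε) * y * ((1 + y / n) ^ (n + 1))⁻¹ -
        α * Real.exp (-α * l) * Real.exp (-Real.exp (-α * l))| * Real.exp (-l) ≤
      (2 + 20 * α + 4 * α / (α - η)) * (h + 1 / n) := by
  obtain ⟨hL0, hL1, hL2⟩ := log_natCast_sub_log_bounds hn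
  set L := Real.log n - Real.log (n - 1)
  have hn0 : (0 : ℝ) < n := by exact_mod_cast (by omega : 0 < n)
  set κ := α - η with hκ
  have hκ0 : 0 < κ := by linarith
  have hb := abs_le.1 hlog
  have hhl : h * l ≤ η * l := by gcongr
  have hE1 : Real.exp (-κ * l) ≤ 1 := Real.exp_le_one_iff.2 (by nlinarith)
  have hE0 := Real.exp_pos (-κ * l)
  have hyE : Real.exp (Real.log y) ≤ 2 * Real.exp (-κ * l) :=
    calc Real.exp (Real.log y) ≤ Real.exp (L + -κ * l) :=
          Real.exp_le_exp.2 (by rw [hκ]; nlinarith [hb.2])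
      _ ≤ 2 * Real.exp (-κ * l) := by rw [Real.exp_add]; gcongr
  have hzE : Real.exp (-α * l) ≤ Real.exp (-κ * l) :=
    Real.exp_le_exp.2 (by rw [hκ]; nlinarith)
  set z := Real.exp (-α * l) with hz
  have hz0 : 0 < z := Real.exp_pos _
  have hz1 : z ≤ 1 := hzE.trans hE1
  have hyz : |y - z| ≤ 2 * h / κ + 4 / n := by
    have h1 := abs_exp_sub_exp_le hyE (hzE.trans (by linarith))
    rw [Real.exp_log hy] at h1
    have h2 : |Real.log y - -α * l| ≤ h * l + 2 / n := by
      rw [abs_le]; constructor <;> linarith [hb.1, hb.2]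
    -- The decay of `y` and `z` absorbs the factor `log x`, uniformly in `x`.
    have h3 : l * Real.exp (-κ * l) ≤ 1 / κ := by
      rw [le_div_iff₀ hκ0, neg_mul, Real.exp_neg]
      have := Real.add_one_le_exp (κ * l)
      rw [mul_assoc, mul_comm _ κ, ← mul_assoc, ← div_eq_mul_inv, div_le_one (Real.exp_pos _)]
      linarith
    calc |y - z| ≤ |Real.log y - -α * l| * (2 * Real.exp (-κ * l)) := h1
      _ ≤ (h * l + 2 / n) * (2 * Real.exp (-κ * l)) := by gcongr
      _ = 2 * h * (l * Real.exp (-κ * l)) + 4 / n * Real.exp (-κ * l) := by ring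
      _ ≤ 2 * h * (1 / κ) + 4 / n * 1 := by gcongr
      _ = _ := by ring
  rw [Real.exp_log hy] at hyE
  have hy2 : y ≤ 2 := by linarith
  have hB : ((1 + y / n) ^ (n + 1))⁻¹ ≤ 1 :=
    inv_le_one_of_one_le₀ (one_le_pow₀ (by have : 0 ≤ y / n := by positivity
                                           linarith))
  have hmain := abs_kernel_sub_le (by omega : 1 ≤ n) (ε := ε) hα hy.le hz0.le hB
    (Real.exp_le_one_iff.2 (by linarith)) (Real.exp_le_one_iff.2 (by linarith))
  have hexl : Real.exp (-l) ≤ 1 := Real.exp_le_one_iff.2 (by linarith)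
  have hyy : y * (y + y ^ 2) ≤ 12 := by
    calc y * (y + y ^ 2) ≤ 2 * (2 + 2 ^ 2) := by gcongr
      _ = 12 := by norm_num
  calc _ ≤ (|ε| * y + α * (y * (y + y ^ 2)) / n + α * (|y - z| * (1 + z))) * 1 * 1 := by gcongr
    _ ≤ (h * 2 + α * 12 / n + α * ((2 * h / κ + 4 / n) * (1 + 1))) * 1 * 1 := by gcongr
    _ ≤ (2 + 20 * α + 4 * α / κ) * (h + 1 / n) := by
        have h1 : 0 ≤ 20 * α * h + 2 / n + 4 * α / κ * (1 / n) := by positivity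
        have h2 : (2 + 20 * α + 4 * α / κ) * (h + 1 / n) - (h * 2 + α * 12 / n +
          α * ((2 * h / κ + 4 / n) * (1 + 1))) * 1 * 1 =
            20 * α * h + 2 / n + 4 * α / κ * (1 / n) := by ring
        linarith

/-- The comparison to the left of `1`; here `l = -log x`. -/
lemma kernel_bound_left {n N : ℕ} (hn : 2 ≤ n) (hN : 1 ≤ N) (hNn : N ≤ n) {α η ρ h e ε l y : ℝ}
    (hα : 0 < α) (hηα : η < α) (hρ : 0 < ρ) (hNbig : ρ + 2 + 6 * α ≤ (α - η) * N)
    (hh : 0 ≤ h) (heη : e ≤ η) (heh : e ≤ h * Real.exp (ρ * l))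
    (hε : |ε| ≤ e) (hl : 0 ≤ l) (hy : 0 < y)
    (hlog : |Real.log y - (Real.log n - Real.log (n - 1)) - α * l| ≤ e * l) :
    |(α + ε) * y * ((1 + y / n) ^ (n + 1))⁻¹ -
        α * Real.exp (α * l) * Real.exp (-Real.exp (α * l))| * Real.exp l ≤
      (N : ℝ) ^ N * (2 + 20 * α) * (h + 1 / n) := by
  obtain ⟨hL0, hL1, hL2⟩ := log_natCast_sub_log_bounds hn
  set L := Real.log n - Real.log (n - 1)
  have hn0 : (0 : ℝ) < n := by exact_mod_cast (by omega : 0 < n)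
  have hN0 : (0 : ℝ) < N := by exact_mod_cast hN
  have hκ0 : 0 < α - η := by linarith
  have he0 : 0 ≤ e := (abs_nonneg ε).trans hε
  have hb := abs_le.1 hlog
  have hel : e * l ≤ η * l := by gcongr
  have hηl : η * l ≤ α * l := by gcongr
  -- `T = x^(-2α)` dominates `z`, and `2 T` dominates `y`, because `α + η ≤ 2α`.
  set T := Real.exp (2 * α * l) with hT
  have hT1 : 1 ≤ T := Real.one_le_exp (by positivity)
  have hyT : Real.exp (Real.log y) ≤ 2 * T :=
    calc Real.exp (Real.log y) ≤ Real.exp (L + 2 * α * l) :=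
          Real.exp_le_exp.2 (by linarith [hb.2])
      _ ≤ 2 * T := by rw [Real.exp_add]; gcongr
  have hzT : Real.exp (α * l) ≤ T := Real.exp_le_exp.2 (by nlinarith)
  have hylow : Real.exp ((α - η) * l) ≤ y := by
    rw [← Real.le_log_iff_exp_le hy]; linarith [hb.1]
  have hzlow : Real.exp ((α - η) * l) ≤ Real.exp (α * l) :=
    Real.exp_le_exp.2 (by nlinarith [(abs_nonneg ε).trans (hε.trans heη)])
  set z := Real.exp (α * l) with hz
  have hz0 : 0 < z := Real.exp_pos _
  set R := Real.exp (ρ * l) with hR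
  have hR1 : 1 ≤ R := Real.one_le_exp (by positivity)
  set E := Real.exp l with hE
  have hE1 : 1 ≤ E := Real.one_le_exp hl
  have hlE : l ≤ E := by linarith [Real.add_one_le_exp l]
  have hyz : |y - z| ≤ 4 * (h + 1 / n) * (R * E * T) := by
    have h1 := abs_exp_sub_exp_le hyT (hzT.trans (by linarith))
    rw [Real.exp_log hy] at h1
    have h2 : |Real.log y - α * l| ≤ e * l + 2 / n := by
      rw [abs_le]; constructor <;> linarith [hb.1, hb.2]
    have hRE : 1 ≤ R * E := one_le_mul_of_one_le_of_one_le hR1 hE1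
    calc |y - z| ≤ |Real.log y - α * l| * (2 * T) := h1
      _ ≤ (e * l + 2 / n) * (2 * T) := by gcongr
      _ ≤ (h * R * E + 2 / n * (R * E)) * (2 * T) := by
          gcongr
          exact le_mul_of_one_le_right (by positivity) hRE
      _ ≤ 4 * (h + 1 / n) * (R * E * T) := by
          have h1 : 0 ≤ h * (R * E * T) := by positivity
          have h2 : 4 * (h + 1 / n) * (R * E * T) - (h * R * E + 2 / n * (R * E)) * (2 * T) =
            2 * (h * (R * E * T)) := by ring
          linarith
  rw [Real.exp_log hy] at hyT
  set K := (N : ℝ) ^ N * ((Real.exp ((α - η) * l)) ^ N)⁻¹ with hK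
  have hKmono : ∀ v, Real.exp ((α - η) * l) ≤ v → (N : ℝ) ^ N * (v ^ N)⁻¹ ≤ K := by
    intro v hv; rw [hK]; gcongr
  have hmain := abs_kernel_sub_le (by omega : 1 ≤ n) (ε := ε) hα hy.le hz0.le
    ((inv_one_add_div_pow_le hN hNn hy).trans (hKmono y hylow))
    ((exp_neg_le_inv_pow hN hy).trans (hKmono y hylow))
    ((exp_neg_le_inv_pow hN hz0).trans (hKmono z hzlow))
  have hK0 : 0 ≤ K := by positivity
  have hTT : T ≤ T ^ 3 := le_self_pow₀ hT1 (by norm_num)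
  have hTT2 : T ^ 2 ≤ T ^ 3 := pow_le_pow_right₀ hT1 (by norm_num)
  have hyy : y * (y + y ^ 2) ≤ 12 * T ^ 3 := by
    calc y * (y + y ^ 2) ≤ (2 * T) * (2 * T + (2 * T) ^ 2) := by gcongr
      _ = 4 * T ^ 2 + 8 * T ^ 3 := by ring
      _ ≤ 12 * T ^ 3 := by linarith
  -- The exponents balance by `hNbig`: `R` costs `ρ`, the two factors `E` (one for `l ≤ e^l`, one
  -- for `1/x`) cost `2`, `T ^ 3` costs `6α`, and `K` gains `(α - η) N`.
  have hfin : K * (R * E * T ^ 3) * E ≤ (N : ℝ) ^ N := by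
    have h1 : K * (R * E * T ^ 3) * E = (N : ℝ) ^ N *
        Real.exp ((ρ + 2 + 6 * α - (α - η) * N) * l) := by
      have : ((ρ + 2 + 6 * α - (α - η) * N) * l) =
        -(N * ((α - η) * l)) + ρ * l + l + l + (3 : ℕ) * (2 * α * l) := by push_cast; ring
      rw [this]
      simp only [Real.exp_add, Real.exp_neg, Real.exp_nat_mul, hK, hR, hE, hT]
      ring
    rw [h1]
    refine mul_le_of_le_one_right (by positivity) (Real.exp_le_one_iff.2 ?_)
    nlinarith
  have hS1 : h * R * (2 * T) ≤ 2 * h * (R * E * T ^ 3) := by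
    calc h * R * (2 * T) = 2 * h * (R * 1 * T) := by ring
      _ ≤ 2 * h * (R * E * T ^ 3) := by gcongr
  have hS2 : α * (12 * T ^ 3) / n ≤ 12 * α * (1 / n) * (R * E * T ^ 3) := by
    calc α * (12 * T ^ 3) / n = 12 * α * (1 / n) * (1 * 1 * T ^ 3) := by ring
      _ ≤ 12 * α * (1 / n) * (R * E * T ^ 3) := by gcongr
  have hS3 : α * (4 * (h + 1 / n) * (R * E * T) * (2 * T)) ≤
      8 * α * (h + 1 / n) * (R * E * T ^ 3) := by
    calc α * (4 * (h + 1 / n) * (R * E * T) * (2 * T)) =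
          8 * α * (h + 1 / n) * (R * E * T ^ 2) := by ring
      _ ≤ 8 * α * (h + 1 / n) * (R * E * T ^ 3) := by gcongr
  have hsum : |ε| * y + α * (y * (y + y ^ 2)) / n + α * (|y - z| * (1 + z)) ≤
      (2 + 20 * α) * (h + 1 / n) * (R * E * T ^ 3) := by
    calc |ε| * y + α * (y * (y + y ^ 2)) / n + α * (|y - z| * (1 + z))
        ≤ h * R * (2 * T) + α * (12 * T ^ 3) / n +
          α * (4 * (h + 1 / n) * (R * E * T) * (2 * T)) := by
          gcongr
          · exact hε.trans heh
          · linarith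
      _ ≤ 2 * h * (R * E * T ^ 3) + 12 * α * (1 / n) * (R * E * T ^ 3) +
          8 * α * (h + 1 / n) * (R * E * T ^ 3) := by gcongr
      _ = (2 * h + 12 * α * (1 / n) + 8 * α * (h + 1 / n)) * (R * E * T ^ 3) := by ring
      _ ≤ (2 + 20 * α) * (h + 1 / n) * (R * E * T ^ 3) := by
          gcongr
          have h1 : 0 ≤ 12 * α * h + 2 * (1 / n) := by positivity
          linarith
  calc _ ≤ (2 + 20 * α) * (h + 1 / n) * (R * E * T ^ 3) * K * E := by
        gcongr; exact hmain.trans (by gcongr)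
    _ = (2 + 20 * α) * (h + 1 / n) * (K * (R * E * T ^ 3) * E) := by ring
    _ ≤ (2 + 20 * α) * (h + 1 / n) * (N : ℝ) ^ N := by gcongr
    _ = _ := by ring

/-! ### Distribution functions with a von Mises tail -/

/-- `F` is the distribution function of the probability density `f`, and the von Mises remainder
stays below `α` on `[δ, ∞)`. -/
structure VonMisesTail (F f : ℝ → ℝ) (α δ : ℝ) : Prop where
  integrable : Integrable f
  nonneg : ∀ x, 0 ≤ f x
  cdf : ∀ x, F x = ∫ t in Iic x, f t
  integral_eq_one : ∫ t, f t = 1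
  alpha_pos : 0 < α
  delta_pos : 0 < δ
  bdd : BddAbove (remainderTail F f α δ)
  lt : remainder F f α δ < α

namespace VonMisesTail

variable {F f : ℝ → ℝ} {α δ : ℝ} (T : VonMisesTail F f α δ)

include T

lemma mem_Ioo {t : ℝ} (ht : δ ≤ t) : 0 < F t ∧ F t < 1 :=
  cdf_mem_Ioo T.alpha_pos T.bdd T.lt (cdf_nonneg T.nonneg T.cdf)
    (fun x => T.integral_eq_one ▸ cdf_le_integral T.integrable T.nonneg T.cdf x) ht

lemma continuous : Continuous F := cdf_continuous T.integrable T.cdf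

lemma monotone : Monotone F := cdf_monotone T.integrable T.nonneg T.cdf

lemma tendsto_atTop : Tendsto F atTop (𝓝 1) :=
  T.integral_eq_one ▸ cdf_tendsto_atTop T.integrable T.cdf

lemma tendsto_atBot : Tendsto F atBot (𝓝 0) := cdf_tendsto_atBot T.integrable T.cdf

lemma lt_one (x : ℝ) : F x < 1 :=
  (T.monotone (le_max_left x δ)).trans_lt (T.mem_Ioo (le_max_right x δ)).2

lemma tendsto_normConst : Tendsto (normConst F) atTop atTop :=
  FrechetRate.tendsto_normConst T.continuous T.monotone T.tendsto_atTop T.tendsto_atBot T.lt_one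

lemma odds_pos {t : ℝ} (ht : δ ≤ t) : 0 < odds F t := by
  have h := T.mem_Ioo ht
  exact div_pos (by linarith) h.1

lemma one_add_odds {t : ℝ} (ht : δ ≤ t) : 1 + odds F t = (F t)⁻¹ := by
  have h := (T.mem_Ioo ht).1.ne'
  rw [odds]; field_simp; ring

lemma odds_normConst {n : ℕ} (hn : 2 ≤ n) : odds F (normConst F n) = 1 / ((n : ℝ) - 1) :=
  FrechetRate.odds_normConst T.continuous T.monotone T.tendsto_atTop T.tendsto_atBot hn

lemma log_odds_normConst {n : ℕ} (hn : 2 ≤ n) :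
    Real.log (odds F (normConst F n)) = -Real.log ((n : ℝ) - 1) := by
  rw [T.odds_normConst hn, one_div, Real.log_inv]

lemma abs_log_odds_sub_le {s t : ℝ} (hs : δ ≤ s) (hst : s ≤ t) :
    |Real.log (odds F t) - Real.log (odds F s) + α * (Real.log t - Real.log s)| ≤
      remainder F f α s * (Real.log t - Real.log s) :=
  FrechetRate.abs_log_odds_sub_le T.integrable T.cdf (T.delta_pos.trans_le hs) hst
    (fun _ hτ => T.mem_Ioo (hs.trans hτ.1)) (fun _ hτ => abs_vonMisesRemainder_le T.bdd hs hτ.1)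

lemma slowPart_eq {t : ℝ} (ht : δ ≤ t) : slowPart F α t = t ^ α * Real.log (1 + odds F t) := by
  rw [T.one_add_odds ht, slowPart, Real.log_inv]; ring

end VonMisesTail

/-! ### The remainder dominates `1 / n` -/

/-- A quantitative form of the decrease of `log (1 + v) / v`: shrinking `v` by a factor `θ < 1`
raises this quotient by a relative amount of order `v`. -/
lemma mul_log_one_add_le {v w θ : ℝ} (hv : 0 < v) (hw : 0 < w) (hθ0 : 0 ≤ θ)
    (hwv : w ≤ θ * v) (hvs : v ≤ (1 - θ) / 2) :
    w * (1 + (1 - θ) / 4 * v) * Real.log (1 + v) ≤ v * Real.log (1 + w) := by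
  have hup : Real.log (1 + v) ≤ v * (1 - v / 2 + v ^ 2 / 2) := by
    rw [Real.log_le_iff_le_exp (by linarith)]
    have hq : 0 ≤ v * (1 - v / 2 + v ^ 2 / 2) := mul_nonneg hv.le (by nlinarith)
    refine le_trans ?_ (Real.quadratic_le_exp_of_nonneg hq)
    have h1 : v * (1 - v / 2) ≤ v * (1 - v / 2 + v ^ 2 / 2) := by gcongr; nlinarith
    have h0 : 0 ≤ v * (1 - v / 2) := mul_nonneg hv.le (by linarith)
    have h2 := pow_le_pow_left₀ h0 h1 2
    nlinarith [pow_pos hv 4]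
  have hlo : w * (1 - w / 2) ≤ Real.log (1 + w) := by
    refine le_trans ?_ (Real.le_log_one_add_of_nonneg hw.le)
    rw [le_div_iff₀ (by linarith)]
    nlinarith [pow_pos hw 3]
  -- The available gain is `v/2 - w/2 ≥ (1 - θ) v / 2`. Half of it is kept; the other half pays for
  -- `v²/2`, by `hvs`.
  have hmid : (1 + (1 - θ) / 4 * v) * (1 - v / 2 + v ^ 2 / 2) ≤ 1 - w / 2 := by
    have hp : 1 - v / 2 + v ^ 2 / 2 ≤ 1 := by nlinarith
    have hc : 0 ≤ (1 - θ) / 4 * v := mul_nonneg (by linarith) hv.le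
    nlinarith [mul_le_mul_of_nonneg_left hp hc]
  have hc : 0 ≤ 1 + (1 - θ) / 4 * v := by nlinarith
  calc w * (1 + (1 - θ) / 4 * v) * Real.log (1 + v)
      ≤ w * (1 + (1 - θ) / 4 * v) * (v * (1 - v / 2 + v ^ 2 / 2)) := by gcongr
    _ = v * (w * ((1 + (1 - θ) / 4 * v) * (1 - v / 2 + v ^ 2 / 2))) := by ring
    _ ≤ v * (w * (1 - w / 2)) := by gcongr
    _ ≤ v * Real.log (1 + w) := by gcongr

/-- Slow variation is used at `x = 2` only. With `v = u(a_n)` the ratio `L(2a_n)/L(a_n)` is at least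
`(1 - h)(1 + k v)` and at most `1 + c h`, which forces `v = O(h)`. -/
lemma VonMisesTail.eventually_inv_le_remainder {F f : ℝ → ℝ} {α δ : ℝ}
    (T : VonMisesTail F f α δ)
    (hL : SlowlyVaryingWithRemainder (slowPart F α) (remainder F f α) (normConst F)) :
    ∃ C : ℝ, 0 < C ∧ ∀ᶠ n : ℕ in atTop, 1 / (n : ℝ) ≤ C * remainder F f α (normConst F n) := by
  obtain ⟨c, hc, hcb⟩ := (hL 2 two_pos).exists_pos
  set θ := Real.exp (-(α - remainder F f α δ) * Real.log 2) with hθ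
  have hlog2 : 0 < Real.log 2 := Real.log_pos one_lt_two
  have hlog2' : Real.log 2 ≤ 1 := by linarith [Real.log_two_lt_d9]
  have hκ : 0 < α - remainder F f α δ := sub_pos.2 T.lt
  have hθ0 : 0 < θ := Real.exp_pos _
  have hθ1 : θ < 1 := by
    rw [hθ, ← Real.exp_zero]
    exact Real.exp_lt_exp.2 (by nlinarith)
  set k := (1 - θ) / 4 with hk
  have hk0 : 0 < k := by rw [hk]; linarith
  refine ⟨(c + 2) / k, by positivity, ?_⟩
  have hv : Tendsto (fun n : ℕ => 1 / ((n : ℝ) - 1)) atTop (𝓝 0) := by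
    simp only [one_div]
    exact tendsto_inv_atTop_zero.comp
      (tendsto_atTop_add_const_right _ (-1 : ℝ) tendsto_natCast_atTop_atTop)
  filter_upwards [hcb.bound, eventually_ge_atTop 2, T.tendsto_normConst.eventually_ge_atTop δ,
    hv.eventually_le_const (show (0 : ℝ) < (1 - θ) / 2 by linarith)] with n hn hn2 ha hvs
  set a := normConst F n
  set h := remainder F f α a
  have ha0 : 0 < a := T.delta_pos.trans_le ha
  have hh0 : 0 ≤ h := remainder_nonneg T.bdd ha
  have hhδ : h ≤ remainder F f α δ := remainder_anti T.bdd le_rfl ha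
  have hn' : (2 : ℝ) ≤ n := by exact_mod_cast hn2
  rw [← T.odds_normConst hn2] at hvs
  have hnv : 1 / (n : ℝ) ≤ odds F a := by
    rw [T.odds_normConst hn2]
    exact one_div_le_one_div_of_le (by linarith) (by linarith)
  have hv0 := T.odds_pos ha
  have ha2 : a ≤ a * 2 := by linarith
  have hw0 := T.odds_pos (ha.trans ha2)
  have hb := T.abs_log_odds_sub_le ha ha2
  rw [Real.log_mul ha0.ne' two_ne_zero, add_sub_cancel_left] at hb
  have hb := abs_le.1 hb
  rw [T.slowPart_eq ha, T.slowPart_eq (ha.trans ha2)] at hn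
  set v := odds F a
  set w := odds F (a * 2)
  have hwv : w ≤ θ * v := by
    rw [← Real.exp_log hv0, ← Real.exp_log hw0, hθ, ← Real.exp_add]
    exact Real.exp_le_exp.2 (by nlinarith [hb.2])
  have hwlow : v * (1 - h) ≤ 2 ^ α * w := by
    have h1 : 2 ^ α * w = Real.exp (α * Real.log 2 + Real.log w) := by
      rw [Real.exp_add, Real.exp_log hw0, Real.rpow_def_of_pos two_pos, mul_comm α]
    rw [h1]
    calc v * (1 - h) ≤ v * Real.exp (-h) := by
          gcongr; linarith [Real.add_one_le_exp (-h)]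
      _ = Real.exp (Real.log v + -h) := by rw [Real.exp_add, Real.exp_log hv0]
      _ ≤ Real.exp (α * Real.log 2 + Real.log w) :=
          Real.exp_le_exp.2 (by nlinarith [hb.1])
  have hkey := mul_log_one_add_le hv0 hw0 hθ0.le hwv hvs
  have hlv : 0 < Real.log (1 + v) := Real.log_pos (by linarith)
  have hkv : k * v ≤ 1 := by nlinarith
  have hR : (1 - h) * (1 + k * v) ≤
      (a * 2) ^ α * Real.log (1 + w) / (a ^ α * Real.log (1 + v)) := by
    have haα : 0 < a ^ α := Real.rpow_pos_of_pos ha0 α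
    rw [Real.mul_rpow ha0.le two_pos.le, mul_assoc, mul_div_mul_left _ _ haα.ne',
      le_div_iff₀ hlv]
    refine le_of_mul_le_mul_left ?_ hv0
    calc v * ((1 - h) * (1 + k * v) * Real.log (1 + v))
        = v * (1 - h) * ((1 + k * v) * Real.log (1 + v)) := by ring
      _ ≤ 2 ^ α * w * ((1 + k * v) * Real.log (1 + v)) := by gcongr
      _ = 2 ^ α * (w * (1 + k * v) * Real.log (1 + v)) := by ring
      _ ≤ 2 ^ α * (v * Real.log (1 + w)) := by gcongr
      _ = v * (2 ^ α * Real.log (1 + w)) := by ring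
  have hnb := (le_abs_self _).trans hn
  rw [Real.norm_of_nonneg hh0] at hnb
  have hfin : k * v ≤ (c + 2) * h := by nlinarith
  calc 1 / (n : ℝ) ≤ v := hnv
    _ = (k * v) / k := by field_simp
    _ ≤ ((c + 2) * h) / k := by gcongr
    _ = (c + 2) / k * h := by ring

/-! ### The two densities in logarithmic coordinates -/

lemma frechetDensity_eq {α x : ℝ} (hx : 0 < x) :
    frechetDensity α x = α * Real.exp (-α * Real.log x) *
      Real.exp (-Real.exp (-α * Real.log x)) * Real.exp (-Real.log x) := by
  have h1 : x ^ (-(α + 1)) = Real.exp (-α * Real.log x) * Real.exp (-Real.log x) := by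
    rw [Real.rpow_def_of_pos hx, ← Real.exp_add]; congr 1; ring
  have h2 : x ^ (-α) = Real.exp (-α * Real.log x) := by
    rw [Real.rpow_def_of_pos hx]; congr 1; ring
  rw [frechetDensity, if_neg (not_le.2 hx), h1, h2]; ring

lemma frechetDensity_nonneg {α : ℝ} (hα : 0 < α) (x : ℝ) : 0 ≤ frechetDensity α x := by
  rcases le_or_gt x 0 with hx | hx
  · rw [frechetDensity, if_pos hx]
  · rw [frechetDensity_eq hx]; positivity

/-- The Fréchet density vanishes at the origin faster than every power. -/
lemma frechetDensity_le_rpow {α ρ x : ℝ} {N : ℕ} (hα : 0 < α) (hN : 1 ≤ N)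
    (hNbig : α + 1 + ρ ≤ α * N) (hx : 0 < x) (hx1 : x ≤ 1) :
    frechetDensity α x ≤ α * (N : ℝ) ^ N * x ^ ρ := by
  have hl : Real.log x ≤ 0 := Real.log_nonpos hx.le hx1
  rw [frechetDensity_eq hx, Real.rpow_def_of_pos hx]
  have h := exp_neg_le_inv_pow hN (Real.exp_pos (-α * Real.log x))
  calc α * Real.exp (-α * Real.log x) * Real.exp (-Real.exp (-α * Real.log x)) *
        Real.exp (-Real.log x)
      ≤ α * Real.exp (-α * Real.log x) * ((N : ℝ) ^ N * (Real.exp (-α * Real.log x) ^ N)⁻¹) *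
        Real.exp (-Real.log x) := by gcongr
    _ = α * (N : ℝ) ^ N * Real.exp ((α * N - α - 1) * Real.log x) := by
        have : (α * N - α - 1) * Real.log x = -α * Real.log x + -(N * (-α * Real.log x)) +
          -Real.log x := by ring
        rw [this]
        simp only [Real.exp_add, Real.exp_neg, Real.exp_nat_mul]
        ring
    _ ≤ α * (N : ℝ) ^ N * Real.exp (Real.log x * ρ) := by
        refine mul_le_mul_of_nonneg_left (Real.exp_le_exp.2 ?_) (by positivity)
        nlinarith

/-- Substitute `t f(t) = (α + ε(t)) F (1 - F)` and `F = 1 / (1 + u)`; the quotient `n * u / n` is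
left unreduced to match `abs_kernel_sub_le` with `y = n u`. -/
lemma VonMisesTail.maxDensity_eq {F f : ℝ → ℝ} {α δ : ℝ} (T : VonMisesTail F f α δ) {n : ℕ}
    (hn : 1 ≤ n) {x : ℝ} (hx : 0 < x) (hax : δ ≤ normConst F n * x) :
    maxDensity F f n x = (α + vonMisesRemainder F f α (normConst F n * x)) *
      (n * odds F (normConst F n * x)) *
      ((1 + n * odds F (normConst F n * x) / n) ^ (n + 1))⁻¹ * Real.exp (-Real.log x) := by
  have hn0 : (n : ℝ) ≠ 0 := by exact_mod_cast (by omega : n ≠ 0)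
  have hm := T.mem_Ioo hax
  have hF0 : F (normConst F n * x) ≠ 0 := hm.1.ne'
  have hF1 : 1 - F (normConst F n * x) ≠ 0 := by linarith
  rw [mul_div_cancel_left₀ _ hn0, T.one_add_odds hax, Real.exp_neg, Real.exp_log hx, inv_pow,
    inv_inv, maxDensity, vonMisesRemainder, odds]
  obtain ⟨m, rfl⟩ : ∃ m, n = m + 1 := ⟨n - 1, by omega⟩
  rw [Nat.add_sub_cancel]
  field_simp
  ring

/-! ### Uniform comparison of the densities -/

namespace VonMisesTail

variable {F f : ℝ → ℝ} {α δ : ℝ} (T : VonMisesTail F f α δ)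

include T

lemma abs_sub_le_of_one_le {n : ℕ} (hn : 2 ≤ n) (ha : δ ≤ normConst F n) {x : ℝ} (hx : 1 ≤ x) :
    |maxDensity F f n x - frechetDensity α x| ≤
      (2 + 20 * α + 4 * α / (α - remainder F f α δ)) *
        (remainder F f α (normConst F n) + 1 / n) := by
  have hx0 : 0 < x := by linarith
  set a := normConst F n with ha'
  have ha0 : 0 < a := T.delta_pos.trans_le ha
  have hax : a ≤ a * x := le_mul_of_one_le_right ha0.le hx
  have hn0 : (0 : ℝ) < n := by exact_mod_cast (by omega : 0 < n)
  have hu := T.odds_pos (ha.trans hax)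
  rw [T.maxDensity_eq (by omega) hx0 (ha.trans hax), frechetDensity_eq hx0, ← sub_mul, abs_mul,
    abs_of_pos (Real.exp_pos (-Real.log x))]
  refine kernel_bound_right hn T.alpha_pos T.lt (remainder_nonneg T.bdd ha)
    (remainder_anti T.bdd le_rfl ha) (abs_vonMisesRemainder_le T.bdd ha hax)
    (Real.log_nonneg hx) (by positivity) ?_
  have hb := T.abs_log_odds_sub_le ha hax
  rw [Real.log_mul ha0.ne' hx0.ne', add_sub_cancel_left, ha', T.log_odds_normConst hn] at hb
  rw [Real.log_mul hn0.ne' hu.ne']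
  convert! hb using 2
  ring

lemma abs_sub_le_of_le_one {ρ : ℝ} (hρ : 0 < ρ) {N n : ℕ} (hN : 1 ≤ N) (hNn : N ≤ n)
    (hNbig : ρ + 2 + 6 * α ≤ (α - remainder F f α δ) * N) (hn : 2 ≤ n)
    (ha : δ ≤ normConst F n) {x : ℝ} (hx0 : 0 < x) (hax : δ ≤ normConst F n * x) (hx : x ≤ 1)
    (hcon : remainder F f α (normConst F n * x) ≤ remainder F f α (normConst F n) * x ^ (-ρ)) :
    |maxDensity F f n x - frechetDensity α x| ≤
      (N : ℝ) ^ N * (2 + 20 * α) * (remainder F f α (normConst F n) + 1 / n) := by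
  set a := normConst F n with ha'
  have ha0 : 0 < a := T.delta_pos.trans_le ha
  have hxa : a * x ≤ a := mul_le_of_le_one_right ha0.le hx
  have hn0 : (0 : ℝ) < n := by exact_mod_cast (by omega : 0 < n)
  have hu := T.odds_pos hax
  rw [T.maxDensity_eq (by omega) hx0 hax, frechetDensity_eq hx0, ← sub_mul, abs_mul,
    abs_of_pos (Real.exp_pos (-Real.log x)), neg_mul_comm]
  refine kernel_bound_left hn hN hNn T.alpha_pos T.lt hρ hNbig (remainder_nonneg T.bdd ha)
    (remainder_anti T.bdd le_rfl hax) ?_ (abs_vonMisesRemainder_le T.bdd hax le_rfl)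
    (neg_nonneg.2 (Real.log_nonpos hx0.le hx)) (by positivity) ?_
  · rwa [Real.rpow_def_of_pos hx0, mul_neg, mul_comm (Real.log x), ← mul_neg] at hcon
  · have hb := T.abs_log_odds_sub_le hax hxa
    rw [Real.log_mul ha0.ne' hx0.ne', ha', T.log_odds_normConst hn, sub_add_cancel_left,
      ← abs_neg] at hb
    rw [Real.log_mul hn0.ne' hu.ne']
    convert! hb using 2
    ring

/-- The norming constants grow at most polynomially. -/
lemma normConst_le_pow : ∃ D : ℝ, 0 < D ∧ ∃ M : ℕ, ∀ n : ℕ, 2 ≤ n → δ ≤ normConst F n →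
    normConst F n ≤ D * (n : ℝ) ^ M := by
  have hκ : 0 < α - remainder F f α δ := sub_pos.2 T.lt
  set κ := α - remainder F f α δ with hκd
  obtain ⟨M, hM⟩ := exists_nat_ge (1 / κ)
  set c := Real.log δ + Real.log (odds F δ) / κ with hc
  refine ⟨Real.exp c, Real.exp_pos _, M, fun n hn ha => ?_⟩
  have hn' : (2 : ℝ) ≤ n := by exact_mod_cast hn
  have ha0 := T.delta_pos.trans_le ha
  have hb := (abs_le.1 (T.abs_log_odds_sub_le le_rfl ha)).2
  rw [T.log_odds_normConst hn] at hb
  have hln : Real.log ((n : ℝ) - 1) ≤ Real.log n := Real.log_le_log (by linarith) (by linarith)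
  have hln0 : 0 ≤ Real.log (n : ℝ) := Real.log_nonneg (by linarith)
  have h1 : κ * (Real.log (normConst F n) - Real.log δ) ≤ Real.log n + Real.log (odds F δ) := by
    rw [hκd]; linarith
  have h2 : Real.log (normConst F n) ≤ c + M * Real.log n := by
    rw [mul_comm, ← le_div_iff₀ hκ, add_div] at h1
    have h3 : Real.log n / κ ≤ M * Real.log n := by
      rw [div_eq_mul_one_div, mul_comm]; gcongr
    rw [hc]; linarith
  calc normConst F n = Real.exp (Real.log (normConst F n)) := (Real.exp_log ha0).symm
    _ ≤ Real.exp (c + M * Real.log n) := Real.exp_le_exp.2 h2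
    _ = Real.exp c * (n : ℝ) ^ M := by
        rw [Real.exp_add, Real.exp_nat_mul, Real.exp_log (by linarith)]

/-- Here `F ≤ F(δ) < 1`, so the factor `F ^ (n - 1)` is geometrically small, while `f` is bounded
and `a_n` grows polynomially. -/
lemma eventually_maxDensity_le (hf_bdd : BddAbove (range f)) :
    ∀ᶠ n : ℕ in atTop, ∀ x, normConst F n * x ≤ δ → maxDensity F f n x ≤ 1 / n := by
  obtain ⟨S, hS⟩ := hf_bdd
  have hS' : ∀ x, f x ≤ S := fun x => hS (mem_range_self x)
  have hS0 : 0 ≤ S := (T.nonneg 0).trans (hS' 0)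
  obtain ⟨D, hD, M, hM⟩ := T.normConst_le_pow
  obtain ⟨hq0, hq1⟩ := T.mem_Ioo le_rfl
  set q := F δ
  -- In the exponent, `M` comes from `a_n`, one from the factor `n` in `g_n`, and one from the
  -- target `1/n`.
  have hlim : Tendsto (fun n : ℕ => D * S / q * ((n : ℝ) ^ (M + 2) * q ^ n)) atTop
      (𝓝 (D * S / q * 0)) :=
    (tendsto_pow_const_mul_const_pow_of_abs_lt_one (M + 2)
      (by rwa [abs_of_pos hq0])).const_mul _
  rw [mul_zero] at hlim
  filter_upwards [hlim.eventually_le_const one_pos, eventually_ge_atTop 2,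
    T.tendsto_normConst.eventually_ge_atTop δ] with n hn hn2 ha x hx
  have hn0 : (0 : ℝ) < n := by exact_mod_cast (by omega : 0 < n)
  have ha0 := T.delta_pos.trans_le ha
  have hF0 := cdf_nonneg T.nonneg T.cdf (normConst F n * x)
  have hqn : q ^ (n - 1) = q ^ n / q := by
    rw [eq_div_iff hq0.ne', ← pow_succ, Nat.sub_add_cancel (by omega)]
  have hg : maxDensity F f n x ≤ n * (D * (n : ℝ) ^ M) * S * q ^ (n - 1) := by
    unfold maxDensity
    have := T.nonneg (normConst F n * x)
    gcongr
    · exact hM n hn2 ha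
    · exact hS' _
    · exact T.monotone hx
  refine hg.trans ?_
  rw [le_div_iff₀ hn0, hqn]
  refine le_trans (le_of_eq ?_) hn
  ring

/-- The uniform rate of convergence of the density of the normalised maximum. -/
theorem eventually_abs_sub_le {ρ : ℝ} (hρ : 0 < ρ)
    (hL : SlowlyVaryingWithRemainder (slowPart F α) (remainder F f α) (normConst F))
    (hcon : ∀ n : ℕ, 1 ≤ n → δ < normConst F n → ∀ x : ℝ, δ / normConst F n ≤ x → x ≤ 1 →
      remainder F f α (normConst F n * x) / remainder F f α (normConst F n) ≤ x ^ (-ρ))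
    (hf_bdd : BddAbove (range f)) :
    ∃ C : ℝ, 0 < C ∧ ∀ᶠ n : ℕ in atTop, ∀ x : ℝ,
      |maxDensity F f n x - frechetDensity α x| ≤ C * remainder F f α (normConst F n) := by
  have hα := T.alpha_pos
  obtain ⟨C, hC, hCn⟩ := T.eventually_inv_le_remainder hL
  have hκ : 0 < α - remainder F f α δ := sub_pos.2 T.lt
  obtain ⟨N, hN⟩ := exists_nat_ge ((ρ + 2 + 6 * α) / (α - remainder F f α δ))
  have hNbig : ρ + 2 + 6 * α ≤ (α - remainder F f α δ) * N :=
    (div_le_iff₀' hκ).1 hN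
  have hN0 : (0 : ℝ) < N := lt_of_lt_of_le (by positivity) hN
  have hN1 : 1 ≤ N := by exact_mod_cast hN0
  have hrδ : 0 ≤ remainder F f α δ := remainder_nonneg T.bdd le_rfl
  have hNα : α + 1 + ρ ≤ α * N := by nlinarith
  set A := 2 + 20 * α + 4 * α / (α - remainder F f α δ)
  set B := (N : ℝ) ^ N * (2 + 20 * α)
  have hA : 0 < A := by positivity
  have hB : 0 < B := by positivity
  set E := α * (N : ℝ) ^ N / remainder F f α δ with hE
  have hE0 : 0 ≤ E := by positivity
  refine ⟨A * (1 + C) + B * (1 + C) + (C + E), by positivity, ?_⟩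
  filter_upwards [hCn, eventually_ge_atTop 2, eventually_ge_atTop N,
    T.tendsto_normConst.eventually_gt_atTop δ, T.eventually_maxDensity_le hf_bdd]
    with n hnC hn2 hNn ha hlow x
  have hn0 : (0 : ℝ) < n := by exact_mod_cast (by omega : 0 < n)
  have ha0 := T.delta_pos.trans ha
  set a := normConst F n
  set h := remainder F f α a
  -- Positivity makes the quotient in `hcon` genuine; it follows from `1/n ≤ C h`.
  have hh0 : 0 < h := by
    have : 0 < C * h := lt_of_lt_of_le (by positivity) hnC
    exact (pos_iff_pos_of_mul_pos this).1 hC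
  have hcon' : ∀ y, δ / a ≤ y → y ≤ 1 → remainder F f α (a * y) ≤ h * y ^ (-ρ) := by
    intro y hy hy1
    have := hcon n (by omega) ha y hy hy1
    rwa [div_le_iff₀' hh0] at this
  have hsum : h + 1 / n ≤ (1 + C) * h := by linarith
  have hP1 : 0 ≤ A * (1 + C) * h := by positivity
  have hP2 : 0 ≤ B * (1 + C) * h := by positivity
  have hP3 : 0 ≤ (C + E) * h := by positivity
  have hsplit : (A * (1 + C) + B * (1 + C) + (C + E)) * h =
    A * (1 + C) * h + B * (1 + C) * h + (C + E) * h := by ring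
  rw [hsplit]
  rcases le_or_gt 1 x with hx1 | hx1
  · have h1 := T.abs_sub_le_of_one_le hn2 ha.le hx1
    have h2 : A * (h + 1 / n) ≤ A * ((1 + C) * h) := by gcongr
    linarith
  rcases le_or_gt (δ / a) x with hxd | hxd
  · have hx0 : 0 < x := lt_of_lt_of_le (div_pos T.delta_pos ha0) hxd
    have h1 := T.abs_sub_le_of_le_one hρ hN1 hNn hNbig hn2 ha.le hx0
      ((div_le_iff₀' ha0).1 hxd) hx1.le (hcon' x hxd hx1.le)
    have h2 : B * (h + 1 / n) ≤ B * ((1 + C) * h) := by gcongr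
    linarith
  · have hg := hlow x ((lt_div_iff₀' ha0).1 hxd).le
    have hg0 : 0 ≤ maxDensity F f n x :=
      mul_nonneg (mul_nonneg (by positivity) (T.nonneg _))
        (pow_nonneg (cdf_nonneg T.nonneg T.cdf _) _)
    have hφ0 := frechetDensity_nonneg hα x
    have hφ : frechetDensity α x ≤ E * h := by
      rcases le_or_gt x 0 with hx0 | hx0
      · rw [frechetDensity, if_pos hx0]; positivity
      · have hda : 0 < δ / a := div_pos T.delta_pos ha0
        have hda1 : δ / a ≤ 1 := (div_le_one ha0).2 ha.le
        -- At the endpoint `x = δ / a_n` this reads `h(δ) (δ/a_n)^ρ ≤ h(a_n)`, which turns the power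
        -- bound on `φ_α` into a multiple of `h(a_n)`.
        have hδ' := hcon' (δ / a) le_rfl hda1
        rw [mul_div_cancel₀ _ ha0.ne', Real.rpow_neg hda.le, ← div_eq_mul_inv,
          le_div_iff₀ (Real.rpow_pos_of_pos hda ρ)] at hδ'
        have hrpos : 0 < remainder F f α δ := hh0.trans_le (remainder_anti T.bdd le_rfl ha.le)
        calc frechetDensity α x ≤ α * (N : ℝ) ^ N * x ^ ρ :=
              frechetDensity_le_rpow hα hN1 hNα hx0 hx1.le
          _ ≤ α * (N : ℝ) ^ N * (δ / a) ^ ρ := by gcongr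
          _ = E * (remainder F f α δ * (δ / a) ^ ρ) := by rw [hE]; field_simp
          _ ≤ E * h := by gcongr
    rw [abs_le]
    constructor <;> nlinarith

end VonMisesTail

end FrechetRate

open FrechetRate in
theorem mainTheorem2 {Ω : Type*} [MeasurableSpace Ω] (P : Measure Ω) [IsProbabilityMeasure P]
    (X : ℕ → Ω → ℝ) (F f : ℝ → ℝ) (α ρ δ : ℝ)
    (hf_meas : Measurable f) (hf_nonneg : ∀ x, 0 ≤ f x)
    -- `X 0, X 1, …` are iid with density `f` and distribution function `F`
    (hX_indep : iIndepFun X P)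
    (hX_law : ∀ i, HasLaw (X i) (volume.withDensity fun x => ENNReal.ofReal (f x)) P)
    (hF : ∀ x, F x = P.real {ω | X 0 ω ≤ x})
    (hα : 0 < α) (hρ : 0 < ρ)
    -- the von Mises condition
    (hvM : Tendsto (vonMisesRemainder F f α) atTop (𝓝 0))
    -- `L` is slowly varying with remainder function `h`
    (hL : SlowlyVaryingWithRemainder (slowPart F α) (remainder F f α) (normConst F))
    -- the choice of `δ`: `h(δ) < α`
    (hδ_pos : 0 < δ) (hδ_bdd : BddAbove (remainderTail F f α δ)) (hδ : remainder F f α δ < α)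
    -- `h(a_n x) / h(a_n) ≤ x^{-ρ}` for `δ / a_n ≤ x ≤ 1`
    (hcon : ∀ n : ℕ, 1 ≤ n → δ < normConst F n → ∀ x : ℝ, δ / normConst F n ≤ x → x ≤ 1 →
      remainder F f α (normConst F n * x) / remainder F f α (normConst F n) ≤ x ^ (-ρ))
    (hf_bdd : BddAbove (range f)) :
    (∀ n : ℕ, 1 ≤ n → 0 < normConst F n →
      HasLaw (fun ω => partialMax X n ω / normConst F n)
        (volume.withDensity fun x => ENNReal.ofReal (maxDensity F f n x)) P) ∧
    ∃ C₁ : ℝ, 0 < C₁ ∧ ∃ C₂ : ℝ, 0 < C₂ ∧ ∀ᶠ n : ℕ in atTop,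
      0 < normConst F n ∧
      BddAbove (range fun x : ℝ => |maxDensity F f n x - frechetDensity α x|) ∧
      (⨆ x : ℝ, |maxDensity F f n x - frechetDensity α x|) <
        C₁ * remainder F f α (normConst F n) + C₂ * (n * Real.exp (-Real.sqrt n)) := by
  have hfi := integrable_of_hasLaw hf_meas hf_nonneg (hX_law 0)
  have hcdf : ∀ x, F x = ∫ t in Iic x, f t := fun x => by
    rw [hF, measureReal_def, measure_Iic_of_hasLaw hf_meas hf_nonneg (hX_law 0),
      ENNReal.toReal_ofReal (integral_nonneg hf_nonneg)]
  have T : VonMisesTail F f α δ :=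
    { integrable := hfi
      nonneg := hf_nonneg
      cdf := hcdf
      integral_eq_one := integral_eq_one_of_hasLaw hf_meas hf_nonneg (hX_law 0)
      alpha_pos := hα
      delta_pos := hδ_pos
      bdd := hδ_bdd
      lt := hδ }
  refine ⟨fun n hn ha => hasLaw_partialMax_div hf_meas hf_nonneg hX_indep hX_law hcdf hn ha, ?_⟩
  obtain ⟨C, hC, hCn⟩ := T.eventually_abs_sub_le hρ hL hcon hf_bdd
  -- The bound `C h(a_n)` already holds; the positive term `n e^(-√n)` only makes the inequality
  -- strict.
  refine ⟨C, hC, 1, one_pos, ?_⟩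
  filter_upwards [hCn, T.tendsto_normConst.eventually_gt_atTop 0, eventually_ge_atTop 1]
    with n hn ha hn1
  refine ⟨ha, ⟨_, forall_mem_range.2 hn⟩, (ciSup_le hn).trans_lt ?_⟩
  have hn0 : (0 : ℝ) < n := by exact_mod_cast hn1
  have : 0 < 1 * (n * Real.exp (-Real.sqrt n)) := by positivity
  linarith
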